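/- Let $(\varepsilon_u)_{u\in\mathbb Z}$ be i.i.d. standard normal random variables, let $(\varepsilon'_u)_{u\in\mathbb Z}$ be an independent copy of this sequence, and let $(a_j)_{j\in\mathbb Z}$ be real numbers with $\sum_{j\in\mathbb Z}|a_j|<\infty$ and $\sum_{j\in\mathbb Z}a_j^2=1$. Let $\varphi:\mathbb R\to\mathbb R$ be measurable and put $$Y_t:=\sum_{j\in\mathbb Z}a_j\varepsilon_{t-j},\qquad X_t:=\varphi(Y_t),\qquad t\in\mathbb Z,$$ where the series converges absolutely almost surely. For $q\ge 0$ let $H_q(x):=(-1)^q e^{x^2/2}\frac{d^q}{dx^q}e^{-x^2/2}$ be the Hermite polynomials, and for $\psi$ with $\psi(Y_0)\in\mathbb L^2$ let $c_q(\psi):=\frac1{q!}\mathbb E[\psi(Y_0)H_q(Y_0)]$. For a measurable $f:\mathbb R^{\mathbb Z}\to\mathbb R$ and the process $Z_t=f((\varepsilon_{t-u})_{u\in\mathbb Z})$ let $\delta_i((Z_t)_{t\in\mathbb Z}):=\|Z_0-Z_0^{*,i}\|_2$, where $Z_0^{*,i}:=f((\varepsilon^{*,i}_{-u})_{u\in\mathbb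 Z})$ with $\varepsilon^{*,i}_i:=\varepsilon'_i$ and $\varepsilon^{*,i}_v:=\varepsilon_v$ for $v\ne i$. (a) If $\varphi(Y_0)\in\mathbb L^2$ and $\mathbb E[\varphi(Y_0)]=0$, then for every $t\in\mathbb Z$ the expansion $\varphi(Y_t)=\sum_{q=1}^\infty c_q(\varphi)H_q(Y_t)$ holds, with convergence in $\mathbb L^2$. (b) Let $m\ge 1$ be an integer and assume $\mathbb E[|\varphi(Y_0)|^{2m}]<\infty$. If $\sum_{j\in\mathbb Z}j^2|a_j|<\infty$ and $$\sum_{k=1}^m\sum_{q=1}^\infty\sqrt{q\cdot q!}\,\bigl|c_q\bigl(\varphi^k-\mathbb E[\varphi^k(Y_0)]\bigr)\bigr|<\infty,$$ then the dependence condition $$\sum_{i\in\mathbb Z}\sum_{k=1}^m i^2\,\delta_i\bigl((X_t^k)_{t\in\mathbb Z}\bigr)<\infty$$ holds. -/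

import Mathlib

open MeasureTheory ProbabilityTheory Filter Topology
open scoped ENNReal

namespace WeakDep

/-- The process `X_t = f ((ε_{t-u})_{u ∈ ℤ})`, a functional of the innovations `ε`. -/
def shiftProcess {Ω : Type*} (f : (ℤ → ℝ) → ℝ) (ε : ℤ → Ω → ℝ) (t : ℤ) (ω : Ω) : ℝ :=
  f (fun u => ε (t - u) ω)

/-- The coupled innovations `ε^{*,i}`: the entry `ε_i` is replaced by `ε'_i`, all the other
entries are kept. -/
def coupledInnov {Ω : Type*} (ε ε' : ℤ → Ω → ℝ) (i : ℤ) : ℤ → Ω → ℝ :=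
  Function.update ε i (ε' i)

/-- The physical dependence measure `δ_i = ‖X_0 - X_0^{*,i}‖_2` of the process
`X_t = f ((ε_{t-u})_u)`, where `X_0^{*,i} = f ((ε^{*,i}_{-u})_u)`. It takes values in `[0, ∞]`. -/
noncomputable def physDep {Ω : Type*} [MeasurableSpace Ω] (P : Measure Ω)
    (f : (ℤ → ℝ) → ℝ) (ε ε' : ℤ → Ω → ℝ) (i : ℤ) : ℝ≥0∞ :=
  eLpNorm (fun ω => shiftProcess f ε 0 ω - shiftProcess f (coupledInnov ε ε' i) 0 ω) 2 P

/-- The dependence condition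
`∑_{i ∈ ℤ} ∑_{k = 1}^m i² δ_i ((X_t^k)_t) < ∞` for `X_t = f ((ε_{t-u})_u)`;
the process `X_t^k` is the functional `f ^ k` of the innovations. -/
def DependenceCondition {Ω : Type*} [MeasurableSpace Ω] (P : Measure Ω)
    (f : (ℤ → ℝ) → ℝ) (ε ε' : ℤ → Ω → ℝ) (m : ℕ) : Prop :=
  ∑' i : ℤ, ∑ k ∈ Finset.Icc 1 m,
    ENNReal.ofReal ((i : ℝ) ^ 2) * physDep P (fun x => f x ^ k) ε ε' i < ∞

/-- The linear functional `x ↦ ∑_{j ∈ ℤ} a_j x_j`; applied to `(ε_{t-u})_u` it gives the linear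
process `Y_t = ∑_j a_j ε_{t-j}`. -/
noncomputable def linFun (a : ℤ → ℝ) (x : ℤ → ℝ) : ℝ := ∑' j : ℤ, a j * x j

/-- The (probabilists') Hermite polynomial `H_q` as a function on `ℝ`. -/
noncomputable def hermiteFun (q : ℕ) (x : ℝ) : ℝ := Polynomial.aeval x (Polynomial.hermite q)

/-- `H_q(x) = (-1)^q exp(x²/2) (d/dx)^q exp(-x²/2)`. -/
theorem hermiteFun_eq (q : ℕ) (x : ℝ) :
    hermiteFun q x = (-1) ^ q * Real.exp (x ^ 2 / 2) *
      iteratedDeriv q (fun y : ℝ => Real.exp (-(y ^ 2 / 2))) x := by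
  rw [hermiteFun, Polynomial.hermite_eq_deriv_gaussian', iteratedDeriv_eq_iterate]
  ring

/-- The Hermite coefficient `c_q(ψ) = (1 / q!) E[ψ(Y) H_q(Y)]`. -/
noncomputable def hermiteCoeff {Ω : Type*} [MeasurableSpace Ω] (P : Measure Ω)
    (Y : Ω → ℝ) (ψ : ℝ → ℝ) (q : ℕ) : ℝ :=
  (1 / (q.factorial : ℝ)) * ∫ ω, ψ (Y ω) * hermiteFun q (Y ω) ∂P

end WeakDep

namespace WeakDep

open Polynomial

/-! ### Hermite polynomials and the standard Gaussian measure -/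

/-! The normalized Hermite polynomials form a Hilbert basis of `L²` of the standard Gaussian
measure. Orthogonality comes from Gaussian integration by parts (`integral_X_mul_polynomial`). For
completeness, a square integrable `f` orthogonal to every `H_q` has vanishing moments, hence the
signed measure with density `f` has vanishing Fourier transform, hence `f = 0` a.e.
(`ae_eq_zero_of_moments_eq_zero`). Since every `Y_t` is standard normal (`map_linFun_gaussian`), the
expansion transfers to `φ(Y_t)`.

For the dependence condition, `ε_i` enters `Y_0` with coefficient `α = a (-i)`. By independence,
`Y_0` and its coupled version have the joint law of `b x + α y` and `b x + α z`, where `x, y, z` are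
independent standard normal and `α² + b² = 1` (`map_coupling_eq`). This pair has correlation `b²`,
so Mehler's formula gives `E[H_q(b x + α y) H_q(b x + α z)] = b^(2q) q!`. The squared distance of
the two Hermite terms is therefore `2 q! (1 - b^(2q))`, at most `2 q! q α²` by Bernoulli's
inequality. Summing the expansion with the triangle inequality bounds `δ_i` by `√2 |a (-i)| ∑ √(q
q!) |c_q|` (`physDep_le`), and the weights `i²` are absorbed by the summability of `j² |a_j|`. -/

/-- The derivative of a Hermite polynomial is a multiple of the previous one. -/
theorem derivative_hermite_succ (n : ℕ) :
    derivative (hermite (n + 1)) = (n + 1 : ℤ[X]) * hermite n := by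
  induction n with
  | zero => simp [hermite_succ]
  | succ n ih =>
    rw [hermite_succ (n + 1), derivative_sub, derivative_mul, ih, derivative_X,
      derivative_mul, hermite_succ n]
    simp only [derivative_add, derivative_natCast, derivative_one]
    push_cast
    ring

/-- The Hermite polynomials with real coefficients. -/
noncomputable def hermiteReal (q : ℕ) : ℝ[X] := (hermite q).map (Int.castRingHom ℝ)

theorem hermiteFun_eq_eval (q : ℕ) (x : ℝ) : hermiteFun q x = (hermiteReal q).eval x := by
  rw [hermiteFun, hermiteReal, eval_map, aeval_def]; rfl

theorem hermiteReal_zero : hermiteReal 0 = 1 := by simp [hermiteReal]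

theorem hermiteReal_succ (q : ℕ) :
    hermiteReal (q + 1) = X * hermiteReal q - derivative (hermiteReal q) := by
  simp [hermiteReal, hermite_succ, derivative_map]

theorem derivative_hermiteReal_succ (q : ℕ) :
    derivative (hermiteReal (q + 1)) = (q + 1 : ℝ[X]) * hermiteReal q := by
  rw [hermiteReal, hermiteReal, derivative_map, derivative_hermite_succ]
  simp

theorem memLp_polynomial (p : ℝ[X]) (r : ℝ≥0∞) (hr : r ≠ ∞) :
    MemLp (fun x => p.eval x) r (gaussianReal 0 1) := by
  induction p using Polynomial.induction_on' generalizing r with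
  | add p q hp hq => simpa using! (hp r hr).add (hq r hr)
  | monomial n c =>
    simp only [eval_monomial]
    refine MemLp.const_mul ?_ c
    induction n generalizing r with
    | zero => simpa using memLp_const (1 : ℝ)
    | succ n ih =>
      -- Hölder with `1/(2r) + 1/(2r) = 1/r`: each extra factor `x` doubles the exponent, so the
      -- induction must hold for all finite `r` at once.
      have h2 : 2 * r ≠ ∞ := ENNReal.mul_ne_top (by simp) hr
      have : ENNReal.HolderTriple (2 * r) (2 * r) r := ⟨by
        rw [ENNReal.mul_inv (by simp) (by simp), ← add_mul, ENNReal.inv_two_add_inv_two, one_mul]⟩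
      simpa only [pow_succ, id] using! (memLp_id_gaussianReal' (μ := 0) (v := 1) _ h2).mul (ih _ h2)

theorem integrable_polynomial (p : ℝ[X]) :
    Integrable (fun x => p.eval x) (gaussianReal 0 1) :=
  memLp_one_iff_integrable.1 (memLp_polynomial p 1 (by simp))

/-- Gaussian integration by parts for polynomials. -/
theorem integral_X_mul_polynomial (p : ℝ[X]) :
    ∫ x, x * p.eval x ∂gaussianReal 0 1 = ∫ x, (derivative p).eval x ∂gaussianReal 0 1 := by
  have hint : ∀ q : ℝ[X], Integrable (fun x => gaussianPDFReal 0 1 x * q.eval x) := by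
    intro q
    have h := integrable_polynomial q
    rw [gaussianReal_of_var_ne_zero _ one_ne_zero, integrable_withDensity_iff_integrable_smul'
      (measurable_gaussianPDF 0 1) (ae_of_all _ fun _ => gaussianPDF_lt_top)] at h
    simpa [toReal_gaussianPDF] using h
  have hpdf : ∀ x : ℝ, HasDerivAt (gaussianPDFReal 0 1) (-x * gaussianPDFReal 0 1 x) x := by
    intro x
    have h1 : HasDerivAt (fun y : ℝ => -(y - 0) ^ 2 / (2 * ((1 : NNReal) : ℝ))) (-x) x := by
      have := (((hasDerivAt_id x).sub_const 0).pow 2).neg.div_const (2 * ((1 : NNReal) : ℝ))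
      refine (this.congr_deriv ?_)
      simp only [id, NNReal.coe_one]
      ring
    rw [gaussianPDFReal_def]
    refine ((h1.exp.const_mul _).congr_deriv ?_)
    ring
  -- The density `g` satisfies `g' = -x g`, so `(g p)' = g (p' - x p)`; the integral of this total
  -- derivative vanishes.
  have h := integral_eq_zero_of_hasDerivAt_of_integrable
    (f := fun x => gaussianPDFReal 0 1 x * p.eval x)
    (f' := fun x => gaussianPDFReal 0 1 x * (derivative p - X * p).eval x)
    (fun x => by
      refine ((hpdf x).mul (p.hasDerivAt x)).congr_deriv ?_
      simp only [eval_sub, eval_mul, eval_X]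
      ring) (hint _) (hint _)
  have h3 := integral_gaussianReal_eq_integral_smul (μ := 0) (v := 1) (one_ne_zero)
    (f := fun x => (derivative p - X * p).eval x)
  simp only [smul_eq_mul] at h3
  rw [h] at h3
  simp only [eval_sub, eval_mul, eval_X] at h3
  rw [integral_sub (integrable_polynomial _)
    (by have := integrable_polynomial (X * p); simpa only [eval_mul, eval_X] using this)] at h3
  linarith

/-- The raising operator `p ↦ X p - p'` is the adjoint of differentiation in the Gaussian inner
product: integrate `H_q p` by parts and cancel the term with `H_q'`. -/
theorem integral_hermiteReal_succ_mul (q : ℕ) (p : ℝ[X]) :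
    ∫ x, (hermiteReal (q + 1)).eval x * p.eval x ∂gaussianReal 0 1 =
      ∫ x, (hermiteReal q).eval x * (derivative p).eval x ∂gaussianReal 0 1 := by
  have h := integral_X_mul_polynomial (hermiteReal q * p)
  have h1 := integrable_polynomial (derivative (hermiteReal q) * p)
  have h2 := integrable_polynomial (hermiteReal q * derivative p)
  have h3 := integrable_polynomial (X * (hermiteReal q * p))
  simp only [eval_mul, eval_X] at h1 h2 h3
  simp only [derivative_mul, eval_add, eval_mul] at h
  rw [integral_add h1 h2] at h
  simp only [hermiteReal_succ, eval_sub, eval_mul, eval_X]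
  have : ∀ x, (x * (hermiteReal q).eval x - (derivative (hermiteReal q)).eval x) * p.eval x =
      x * ((hermiteReal q).eval x * p.eval x) - (derivative (hermiteReal q)).eval x * p.eval x :=
    fun x => by ring
  simp only [this]
  rw [integral_sub h3 h1, h]
  ring

/-- Orthogonality of the Hermite polynomials. -/
theorem integral_hermiteReal_mul_hermiteReal (m n : ℕ) :
    ∫ x, (hermiteReal m).eval x * (hermiteReal n).eval x ∂gaussianReal 0 1 =
      if m = n then (n.factorial : ℝ) else 0 := by
  induction m generalizing n with
  | zero =>
    cases n with
    | zero => simp [hermiteReal_zero]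
    | succ n =>
      simp only [mul_comm ((hermiteReal 0).eval _)]
      rw [integral_hermiteReal_succ_mul]
      simp [hermiteReal_zero]
  | succ m ih =>
    rw [integral_hermiteReal_succ_mul]
    cases n with
    | zero => simp [hermiteReal_zero]
    | succ n =>
      have : ∀ x, (hermiteReal m).eval x * (derivative (hermiteReal (n + 1))).eval x =
          (n + 1) * ((hermiteReal m).eval x * (hermiteReal n).eval x) := by
        intro x
        simp only [derivative_hermiteReal_succ, eval_mul, eval_add, eval_natCast, eval_one]
        ring
      simp only [this]
      rw [integral_const_mul, ih]
      simp [Nat.factorial_succ]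

/-- The Mehler formula: the Hermite polynomials are the eigenfunctions of the
Ornstein-Uhlenbeck semigroup. -/
theorem integral_hermiteReal_affine {a b : ℝ} (hab : a ^ 2 + b ^ 2 = 1) (q : ℕ) (x : ℝ) :
    ∫ y, (hermiteReal q).eval (b * x + a * y) ∂gaussianReal 0 1 =
      b ^ q * (hermiteReal q).eval x := by
  have hcomp : ∀ (p : ℝ[X]) (y : ℝ), p.eval (b * x + a * y) =
      (p.comp (C (b * x) + C a * X)).eval y := fun p y => by simp
  have hint : ∀ p : ℝ[X],
      Integrable (fun y => p.eval (b * x + a * y)) (gaussianReal 0 1) := fun p => by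
    simp only [hcomp]; exact integrable_polynomial _
  have step : ∀ p : ℝ[X],
      ∫ y, (X * p - derivative p).eval (b * x + a * y) ∂gaussianReal 0 1 =
        b * x * ∫ y, p.eval (b * x + a * y) ∂gaussianReal 0 1 -
        b ^ 2 * ∫ y, (derivative p).eval (b * x + a * y) ∂gaussianReal 0 1 := by
    intro p
    -- Integration by parts in `y` produces a factor `a` by the chain rule; with the `a` already
    -- present the coefficient of `p'` is `a² - 1 = -b²`.
    have h := integral_X_mul_polynomial (p.comp (C (b * x) + C a * X))
    simp only [derivative_comp, eval_mul] at h
    simp only [← hcomp] at h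
    simp only [derivative_add, derivative_C, derivative_mul, derivative_X, eval_C,
      zero_mul, mul_one, zero_add] at h
    rw [integral_const_mul] at h
    have h1 : Integrable (fun y => y * p.eval (b * x + a * y)) (gaussianReal 0 1) := by
      have := integrable_polynomial (X * p.comp (C (b * x) + C a * X))
      simpa only [eval_mul, eval_X, ← hcomp] using this
    have e : ∀ y, (X * p - derivative p).eval (b * x + a * y) =
      b * x * p.eval (b * x + a * y) + a * (y * p.eval (b * x + a * y)) -
        (derivative p).eval (b * x + a * y) := fun y => by
      simp only [eval_sub, eval_mul, eval_X]; ring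
    simp only [e]
    rw [integral_sub (by exact ((hint p).const_mul _).add (h1.const_mul _)) (hint _),
      integral_add ((hint p).const_mul _) (h1.const_mul _), integral_const_mul,
      integral_const_mul, h]
    linear_combination (∫ y, (derivative p).eval (b * x + a * y) ∂gaussianReal 0 1) * hab
  -- The derivative of `H_(q+1)` in the recursion for `H_(q+2)` is a multiple of `H_q`, two indices
  -- down.
  induction q using Nat.twoStepInduction with
  | zero => simp [hermiteReal_zero]
  | one =>
    rw [hermiteReal_succ, step]
    simp [hermiteReal_zero]
  | more q ih0 ih1 =>
    rw [hermiteReal_succ (q + 1), step, ih1, derivative_hermiteReal_succ]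
    simp only [eval_mul, eval_add, eval_natCast, eval_one, eval_sub, eval_X]
    rw [integral_const_mul, ih0]
    ring

/-! ### Completeness of the Hermite polynomials -/

theorem memLp_exp_mul_abs (t : ℝ) :
    MemLp (fun x : ℝ => Real.exp (t * |x|)) 2 (gaussianReal 0 1) := by
  rw [memLp_two_iff_integrable_sq (by fun_prop)]
  have h := integrable_exp_mul_abs (X := fun x : ℝ => x) (μ := gaussianReal 0 1) (t := 2 * t)
    (integrable_exp_mul_gaussianReal _) (integrable_exp_mul_gaussianReal _)
  refine h.congr (ae_of_all _ fun x => ?_)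
  simp only
  rw [← Real.exp_nat_mul]
  push_cast
  ring_nf

theorem integrable_polynomial_mul {f : ℝ → ℝ} (hf : MemLp f 2 (gaussianReal 0 1)) (p : ℝ[X]) :
    Integrable (fun x => p.eval x * f x) (gaussianReal 0 1) :=
  (memLp_polynomial p 2 (by simp)).integrable_mul hf

/-- A square integrable function with vanishing moments has vanishing Fourier transform. -/
theorem integral_exp_mul_eq_zero {f : ℝ → ℝ} (hf : MemLp f 2 (gaussianReal 0 1))
    (h0 : ∀ n : ℕ, ∫ x, x ^ n * f x ∂gaussianReal 0 1 = 0) (t : ℝ) :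
    ∫ x, (f x : ℂ) * Complex.exp (t * x * Complex.I) ∂gaussianReal 0 1 = 0 := by
  have hfm : AEStronglyMeasurable (fun x => (f x : ℂ)) (gaussianReal 0 1) :=
    Complex.continuous_ofReal.comp_aestronglyMeasurable hf.aestronglyMeasurable
  have hsum : ∀ x : ℝ, HasSum (fun n : ℕ => |t * x| ^ n / n.factorial * |f x|)
      (Real.exp (|t| * |x|) * |f x|) := fun x => by
    rw [← abs_mul]
    have h := NormedSpace.expSeries_div_hasSum_exp (|t * x|)
    rw [← Real.exp_eq_exp_ℝ] at h
    exact h.mul_right _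
  -- The exponential series is integrated term by term; the dominating sum is `exp(|t| |x|) |f x|`,
  -- integrable by Cauchy–Schwarz.
  have h := hasSum_integral_of_dominated_convergence (μ := gaussianReal 0 1)
    (F := fun (n : ℕ) (x : ℝ) => (f x : ℂ) * ((t * x * Complex.I) ^ n / n.factorial))
    (f := fun x => (f x : ℂ) * Complex.exp (t * x * Complex.I))
    (fun n x => |t * x| ^ n / n.factorial * |f x|)
    (fun n => hfm.mul (by fun_prop))
    (fun n => ae_of_all _ fun x => by
      simp [mul_comm, abs_mul, mul_pow])
    (ae_of_all _ fun x => (hsum x).summable)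
    (by
      simp only [(hsum _).tsum_eq]
      exact (memLp_exp_mul_abs |t|).integrable_mul hf.abs)
    (ae_of_all _ fun x => by
      have h := NormedSpace.expSeries_div_hasSum_exp ((t * x * Complex.I : ℂ))
      rw [← Complex.exp_eq_exp_ℂ] at h
      exact h.mul_left _)
  have hz : ∀ n : ℕ, ∫ x, (f x : ℂ) * ((t * x * Complex.I) ^ n / n.factorial)
      ∂gaussianReal 0 1 = 0 := by
    intro n
    have e : ∀ x : ℝ, (f x : ℂ) * ((t * x * Complex.I) ^ n / n.factorial) =
        ((t * Complex.I) ^ n / n.factorial) * ((x ^ n * f x : ℝ) : ℂ) := fun x => by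
      push_cast
      ring
    simp only [e]
    rw [integral_const_mul, integral_complex_ofReal, h0]
    simp
  simp only [hz] at h
  exact h.unique hasSum_zero

/-- The moment problem for densities which are square integrable with respect to the standard
Gaussian measure. -/
theorem ae_eq_zero_of_moments_eq_zero {f : ℝ → ℝ} (hf : MemLp f 2 (gaussianReal 0 1))
    (h0 : ∀ n : ℕ, ∫ x, x ^ n * f x ∂gaussianReal 0 1 = 0) : f =ᵐ[gaussianReal 0 1] 0 := by
  have hint : Integrable f (gaussianReal 0 1) := hf.integrable one_le_two
  have hm : AEMeasurable f (gaussianReal 0 1) := hint.aemeasurable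
  have hfin : ∀ g : ℝ → ℝ, Integrable g (gaussianReal 0 1) →
      IsFiniteMeasure ((gaussianReal 0 1).withDensity fun x => ENNReal.ofReal (g x)) :=
    fun g hg => isFiniteMeasure_withDensity_ofReal hg.2
  have h1 := hfin f hint
  have hneg : Integrable (fun x => -f x) (gaussianReal 0 1) := hint.neg
  have h2 := hfin _ hneg
  have hchar : ∀ (g : ℝ → ℝ), Integrable g (gaussianReal 0 1) → ∀ t : ℝ,
      charFun ((gaussianReal 0 1).withDensity fun x => ENNReal.ofReal (g x)) t =
        ∫ x, ((max (g x) 0 : ℝ) : ℂ) * Complex.exp (t * x * Complex.I) ∂gaussianReal 0 1 := by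
    intro g hg t
    rw [charFun_apply_real, integral_withDensity_eq_integral_toReal_smul₀
      hg.aemeasurable.ennreal_ofReal (ae_of_all _ fun _ => ENNReal.ofReal_lt_top)]
    simp [ENNReal.toReal_ofReal']
  have hexp : ∀ (g : ℝ → ℝ), Integrable g (gaussianReal 0 1) → ∀ t : ℝ,
      Integrable (fun x => ((max (g x) 0 : ℝ) : ℂ) * Complex.exp (t * x * Complex.I))
        (gaussianReal 0 1) := by
    intro g hg t
    refine hg.pos_part.ofReal.mul_bdd (c := 1) (by fun_prop) (ae_of_all _ fun x => ?_)
    rw [← Complex.ofReal_mul, Complex.norm_exp_ofReal_mul_I]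
  -- The positive and negative parts of `f` are densities of finite measures whose characteristic
  -- functions differ by the Fourier transform of `f`, which is zero.
  have hμ : ((gaussianReal 0 1).withDensity fun x => ENNReal.ofReal (f x)) =
      (gaussianReal 0 1).withDensity fun x => ENNReal.ofReal (-f x) := by
    refine Measure.ext_of_charFun (funext fun t => ?_)
    rw [hchar _ hint, hchar _ hneg, ← sub_eq_zero,
      ← integral_sub (hexp _ hint t) (hexp _ hneg t), ← integral_exp_mul_eq_zero hf h0 t]
    refine integral_congr_ae (ae_of_all _ fun x => ?_)
    simp only
    rw [← sub_mul, ← Complex.ofReal_sub]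
    congr 2
    rcases le_total 0 (f x) with h | h
    · simp [h]
    · simp [h]
  rw [withDensity_eq_iff_of_sigmaFinite hm.ennreal_ofReal
    hneg.aemeasurable.ennreal_ofReal] at hμ
  filter_upwards [hμ] with x hx
  rcases le_total 0 (f x) with h | h
  · rw [ENNReal.ofReal_of_nonpos (neg_nonpos.2 h), ENNReal.ofReal_eq_zero] at hx
    exact le_antisymm hx h
  · rw [ENNReal.ofReal_of_nonpos h, eq_comm, ENNReal.ofReal_eq_zero] at hx
    exact le_antisymm h (by simpa using hx)

/-- The Hermite polynomials are complete in `L²` of the standard Gaussian measure. -/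
theorem ae_eq_zero_of_integral_hermiteReal_mul_eq_zero {f : ℝ → ℝ}
    (hf : MemLp f 2 (gaussianReal 0 1))
    (h0 : ∀ q : ℕ, ∫ x, (hermiteReal q).eval x * f x ∂gaussianReal 0 1 = 0) :
    f =ᵐ[gaussianReal 0 1] 0 := by
  -- The factor `X ^ n` strengthens the induction: `X H_q = H_(q+1) + H_q'` trades one power of `X`
  -- for neighbouring Hermite indices, and `q = 0` yields all moments.
  have key : ∀ n q : ℕ, ∫ x, (X ^ n * hermiteReal q).eval x * f x ∂gaussianReal 0 1 = 0 := by
    intro n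
    induction n with
    | zero => simpa using h0
    | succ n ih =>
      intro q
      have hq : ∫ x, (X ^ n * derivative (hermiteReal q)).eval x * f x ∂gaussianReal 0 1 = 0 := by
        cases q with
        | zero => simp [hermiteReal_zero]
        | succ q =>
          have e : ∀ x, (X ^ n * derivative (hermiteReal (q + 1))).eval x * f x =
              (q + 1) * ((X ^ n * hermiteReal q).eval x * f x) := fun x => by
            simp only [derivative_hermiteReal_succ, eval_mul, eval_add, eval_natCast, eval_one]
            ring
          simp only [e]
          rw [integral_const_mul, ih, mul_zero]
      have e : ∀ x, (X ^ (n + 1) * hermiteReal q).eval x * f x =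
          (X ^ n * hermiteReal (q + 1)).eval x * f x +
            (X ^ n * derivative (hermiteReal q)).eval x * f x := fun x => by
        simp only [hermiteReal_succ, eval_mul, eval_sub, eval_pow, eval_X]
        ring
      simp only [e]
      rw [integral_add (integrable_polynomial_mul hf _) (integrable_polynomial_mul hf _),
        ih, hq, add_zero]
  refine ae_eq_zero_of_moments_eq_zero hf fun n => ?_
  simpa [hermiteReal_zero] using key n 0

/-- The normalized Hermite polynomials as elements of `L²` of the standard Gaussian measure. -/
noncomputable def hermiteLp (q : ℕ) : Lp ℝ 2 (gaussianReal 0 1) :=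
  (memLp_polynomial (C (√(q.factorial : ℝ))⁻¹ * hermiteReal q) 2 (by simp)).toLp _

theorem inner_hermiteLp {f : ℝ → ℝ} (hf : MemLp f 2 (gaussianReal 0 1)) (q : ℕ) :
    inner ℝ (hermiteLp q) (hf.toLp f) =
      (√(q.factorial : ℝ))⁻¹ * ∫ x, (hermiteReal q).eval x * f x ∂gaussianReal 0 1 := by
  rw [L2.inner_def, ← integral_const_mul]
  refine integral_congr_ae ?_
  filter_upwards [hf.coeFn_toLp,
    (memLp_polynomial (C (√(q.factorial : ℝ))⁻¹ * hermiteReal q) 2 (by simp)).coeFn_toLp]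
    with x h1 h2
  rw [hermiteLp, h1, h2]
  simp
  ring

theorem orthonormal_hermiteLp : Orthonormal ℝ hermiteLp := by
  classical
  rw [orthonormal_iff_ite]
  intro m n
  conv_lhs => rw [hermiteLp.eq_1 n]
  rw [inner_hermiteLp]
  have e : ∀ x, (hermiteReal m).eval x * (C (√(n.factorial : ℝ))⁻¹ * hermiteReal n).eval x =
      (√(n.factorial : ℝ))⁻¹ * ((hermiteReal m).eval x * (hermiteReal n).eval x) := fun x => by
    simp only [eval_mul, eval_C]
    ring
  simp only [e]
  rw [integral_const_mul, integral_hermiteReal_mul_hermiteReal]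
  split_ifs with h
  · subst h
    have h0 : (0 : ℝ) < m.factorial := by exact_mod_cast m.factorial_pos
    have := Real.sqrt_pos.2 h0
    field_simp
    exact (Real.sq_sqrt h0.le).symm
  · simp

theorem orthogonal_span_hermiteLp : (Submodule.span ℝ (Set.range hermiteLp))ᗮ = ⊥ := by
  rw [Submodule.eq_bot_iff]
  intro g hg
  rw [Submodule.mem_orthogonal] at hg
  have h : ∀ q, ∫ x, (hermiteReal q).eval x * g x ∂gaussianReal 0 1 = 0 := by
    intro q
    have h1 := hg (hermiteLp q) (Submodule.subset_span ⟨q, rfl⟩)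
    rw [← Lp.toLp_coeFn g (Lp.memLp g), inner_hermiteLp] at h1
    rcases mul_eq_zero.1 h1 with h2 | h2
    · have := Real.sqrt_pos.2 (show (0 : ℝ) < q.factorial by exact_mod_cast q.factorial_pos)
      exact absurd h2 (inv_pos.2 this).ne'
    · exact h2
  exact (Lp.eq_zero_iff_ae_eq_zero).2
    (ae_eq_zero_of_integral_hermiteReal_mul_eq_zero (Lp.memLp g) h)

/-- The Hermite expansion of a function which is square integrable with respect to the standard
Gaussian measure. -/
theorem tendsto_hermite_expansion {f : ℝ → ℝ} (hf : MemLp f 2 (gaussianReal 0 1)) :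
    Tendsto (fun N : ℕ => eLpNorm (fun x => f x - ∑ q ∈ Finset.range N,
      (1 / (q.factorial : ℝ) * ∫ y, f y * hermiteFun q y ∂gaussianReal 0 1) * hermiteFun q x)
        2 (gaussianReal 0 1)) atTop (𝓝 0) := by
  set c : ℕ → ℝ := fun q =>
    1 / (q.factorial : ℝ) * ∫ y, f y * hermiteFun q y ∂gaussianReal 0 1 with hc
  set B := HilbertBasis.mkOfOrthogonalEqBot orthonormal_hermiteLp orthogonal_span_hermiteLp
  have hB : ∀ q, B q = hermiteLp q := fun q => by
    rw [HilbertBasis.coe_mkOfOrthogonalEqBot]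
  have hcoef : ∀ q, B.repr (hf.toLp f) q • B q =
      (memLp_polynomial (C (c q) * hermiteReal q) 2 (by simp)).toLp _ := by
    intro q
    -- The factor `1/√q!` occurs in both the coefficient and the basis vector, giving the `1/q!` of
    -- `c q`.
    rw [B.repr_apply_apply, hB, inner_hermiteLp, hermiteLp, ← MemLp.toLp_const_smul]
    congr 1
    ext x
    simp only [Pi.smul_apply, smul_eq_mul, eval_mul, eval_C, hc, hermiteFun_eq_eval,
      mul_comm (f _)]
    have h0 : (0 : ℝ) ≤ q.factorial := by positivity
    have h1 : (√(q.factorial : ℝ))⁻¹ * (√(q.factorial : ℝ))⁻¹ = 1 / q.factorial := by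
      rw [← mul_inv, Real.mul_self_sqrt h0, one_div]
    rw [← h1]
    ring
  have hsum := (B.hasSum_repr (hf.toLp f)).tendsto_sum_nat
  simp only [hcoef] at hsum
  have hpart : ∀ N : ℕ, (∑ q ∈ Finset.range N,
      (memLp_polynomial (C (c q) * hermiteReal q) 2 (by simp)).toLp _ :
        Lp ℝ 2 (gaussianReal 0 1)) =
      (memLp_polynomial (∑ q ∈ Finset.range N, C (c q) * hermiteReal q) 2 (by simp)).toLp _ := by
    intro N
    induction N with
    | zero =>
      simp only [Finset.range_zero, Finset.sum_empty, eval_zero]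
      exact MemLp.zero.toLp_zero.symm
    | succ N ih =>
      simp only [Finset.sum_range_succ, eval_add]
      rw [ih, ← MemLp.toLp_add]
      rfl
  simp only [hpart] at hsum
  rw [Lp.tendsto_Lp_iff_tendsto_eLpNorm''
    (fun N x => (∑ q ∈ Finset.range N, C (c q) * hermiteReal q).eval x)] at hsum
  refine hsum.congr fun N => ?_
  rw [eLpNorm_sub_comm]
  congr 1
  ext x
  simp [eval_finsetSum, hermiteFun_eq_eval, hc]

/-! ### Gaussian linear processes -/

variable {Ω : Type*} [MeasurableSpace Ω] {P : Measure Ω}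

theorem measurable_linFun (a : ℤ → ℝ) : Measurable (linFun a) :=
  Measurable.tsum fun j => measurable_const.mul (measurable_pi_apply j)

/-- A series of standard normal variables with absolutely summable coefficients converges
absolutely almost surely. -/
theorem ae_summable_abs_mul {x : ℤ → Ω → ℝ} (hx : ∀ u, Measurable (x u))
    (hlaw : ∀ u, P.map (x u) = gaussianReal 0 1) {a : ℤ → ℝ} (ha : Summable fun j => |a j|) :
    ∀ᵐ ω ∂P, Summable fun j : ℤ => |a j * x j ω| := by
  have hM : ∫⁻ y : ℝ, ‖y‖ₑ ∂gaussianReal 0 1 ≠ ∞ :=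
    (memLp_one_iff_integrable.1 (memLp_id_gaussianReal' 1 (by simp))).2.ne
  have hsum : ∑' j, ‖a j‖ₑ ≠ ∞ := by
    have := ha.tsum_ofReal_ne_top
    simpa [Real.enorm_eq_ofReal_abs] using this
  -- By Tonelli the expected sum of absolute values is `E|ε_0| ∑ |a_j|`, which is finite; hence the
  -- sum is finite a.s.
  have hfin : ∫⁻ ω, ∑' j, ‖a j * x j ω‖ₑ ∂P ≠ ∞ := by
    rw [lintegral_tsum fun j => by fun_prop]
    have e : ∀ j, ∫⁻ ω, ‖a j * x j ω‖ₑ ∂P = ‖a j‖ₑ * ∫⁻ y : ℝ, ‖y‖ₑ ∂gaussianReal 0 1 := by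
      intro j
      simp only [enorm_mul]
      rw [lintegral_const_mul _ (by fun_prop), ← hlaw j, lintegral_map (by fun_prop) (hx j)]
    simp only [e]
    rw [ENNReal.tsum_mul_right]
    exact ENNReal.mul_ne_top hsum hM
  filter_upwards [ae_lt_top' (by fun_prop) hfin] with ω hω
  have := ENNReal.summable_toReal hω.ne
  simpa using! this

/-- The law of a finite linear combination of independent standard normal variables. -/
theorem map_finset_sum_gaussian [IsProbabilityMeasure P] {x : ℤ → Ω → ℝ}
    (hx : ∀ u, Measurable (x u)) (hind : iIndepFun x P)
    (hlaw : ∀ u, P.map (x u) = gaussianReal 0 1) (a : ℤ → ℝ) (s : Finset ℤ) :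
    P.map (fun ω => ∑ j ∈ s, a j * x j ω) =
      gaussianReal 0 (∑ j ∈ s, ‖a j‖₊ ^ 2) := by
  classical
  have hterm : ∀ j, P.map (fun ω => a j * x j ω) = gaussianReal 0 (‖a j‖₊ ^ 2) := by
    intro j
    have h := gaussianReal_map_const_mul (μ := 0) (v := 1) (a j)
    rw [← hlaw j, Measure.map_map (by fun_prop) (hx j)] at h
    have e : NNReal.mk (a j ^ 2) (sq_nonneg _) = ‖a j‖₊ ^ 2 := by ext; simp
    simpa only [Function.comp_def, mul_zero, mul_one, e] using h
  have hind' : iIndepFun (fun j ω => a j * x j ω) P :=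
    hind.comp (fun j y => a j * y) fun j => by fun_prop
  induction s using Finset.induction_on with
  | empty => simp [Measure.map_const]
  | insert j s hj ih =>
    simp only [Finset.sum_insert hj]
    have h : IndepFun (fun ω => a j * x j ω) (fun ω => ∑ k ∈ s, a k * x k ω) P := by
      have := (hind'.indepFun_finsetSum_of_notMem (fun k => by fun_prop) hj).symm
      simpa [Finset.sum_fn] using! this
    have := gaussianReal_add_gaussianReal_of_indepFun h (hterm j) ih
    simpa [Finset.sum_insert hj] using! this

/-- The law of a Gaussian series. -/
theorem map_linFun_gaussian [IsProbabilityMeasure P] {x : ℤ → Ω → ℝ}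
    (hx : ∀ u, Measurable (x u)) (hind : iIndepFun x P)
    (hlaw : ∀ u, P.map (x u) = gaussianReal 0 1) {a : ℤ → ℝ} (ha : Summable fun j => |a j|)
    {v : NNReal} (hv : HasSum (fun j => a j ^ 2) (v : ℝ)) :
    P.map (fun ω => linFun a fun u => x u ω) = gaussianReal 0 v := by
  have hm : Measurable fun ω => linFun a fun u => x u ω :=
    (measurable_linFun a).comp (measurable_pi_lambda _ hx)
  have : IsProbabilityMeasure (P.map fun ω => linFun a fun u => x u ω) :=
    Measure.isProbabilityMeasure_map hm.aemeasurable
  refine Measure.ext_of_charFun (funext fun t => ?_)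
  rw [charFun_gaussianReal, charFun_apply_real, integral_map hm.aemeasurable (by fun_prop)]
  have hlim : Tendsto (fun s : Finset ℤ => ∫ ω, Complex.exp
      (t * (∑ j ∈ s, a j * x j ω : ℝ) * Complex.I) ∂P) atTop
      (𝓝 (∫ ω, Complex.exp (t * (linFun a fun u => x u ω : ℝ) * Complex.I) ∂P)) := by
    refine tendsto_integral_filter_of_dominated_convergence (fun _ => 1)
      (Eventually.of_forall fun s => by fun_prop)
      (Eventually.of_forall fun s => ae_of_all _ fun ω => ?_) (integrable_const _) ?_
    · rw [← Complex.ofReal_mul, Complex.norm_exp_ofReal_mul_I]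
    · filter_upwards [ae_summable_abs_mul hx hlaw ha] with ω hω
      have h : Tendsto (fun s : Finset ℤ => ∑ j ∈ s, a j * x j ω) atTop
        (𝓝 (linFun a fun u => x u ω)) := (summable_abs_iff.1 hω).hasSum
      have hc : Continuous fun y : ℝ => Complex.exp (t * (y : ℂ) * Complex.I) := by fun_prop
      exact (hc.tendsto _).comp h
  have hlim' : Tendsto (fun s : Finset ℤ => Complex.exp
      (t * (0 : ℝ) * Complex.I - (∑ j ∈ s, a j ^ 2 : ℝ) * t ^ 2 / 2)) atTop
      (𝓝 (Complex.exp (t * (0 : ℝ) * Complex.I - (v : ℝ) * t ^ 2 / 2))) := by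
    have hc : Continuous fun y : ℝ =>
      Complex.exp (t * (0 : ℝ) * Complex.I - (y : ℂ) * t ^ 2 / 2) := by fun_prop
    exact (hc.tendsto _).comp hv
  refine tendsto_nhds_unique hlim (hlim'.congr fun s => ?_)
  have h := charFun_gaussianReal (μ := 0) (v := ∑ j ∈ s, ‖a j‖₊ ^ 2) t
  rw [← map_finset_sum_gaussian hx hind hlaw a s, charFun_apply_real,
    integral_map (by fun_prop) (by fun_prop)] at h
  rw [h]
  simp

/-- Asking measurability only where `a k ≠ 0` allows the σ-algebra to be the one generated by a
subfamily, as the independence argument requires. -/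
theorem measurable_linFun_comp {Ω' : Type*} {m : MeasurableSpace Ω'} {x : ℤ → Ω' → ℝ} {a : ℤ → ℝ}
    (h : ∀ k, a k ≠ 0 → Measurable (x k)) : Measurable fun ω => linFun a fun u => x u ω := by
  refine Measurable.tsum fun k => ?_
  by_cases hk : a k = 0
  · simp [hk]
  · exact (h k hk).const_mul _

/-- A series which does not involve the `j`-th variable is independent of it. -/
theorem indepFun_linFun_update {x : ℤ → Ω → ℝ} (hx : ∀ u, Measurable (x u))
    (hind : iIndepFun x P) (a : ℤ → ℝ) (j : ℤ) :
    IndepFun (fun ω => linFun (Function.update a j 0) fun u => x u ω) (x j) P := by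
  have h := indep_iSup_of_disjoint (fun u => (hx u).comap_le) hind.iIndep
    (S := {j}ᶜ) (T := {j}) disjoint_compl_left
  rw [IndepFun_iff_Indep]
  refine indep_of_indep_of_le_left (indep_of_indep_of_le_right h ?_) ?_
  · simp
  · rw [← measurable_iff_comap_le]
    refine measurable_linFun_comp fun k hk => ?_
    have hkj : k ≠ j := fun hkj => hk (by rw [hkj, Function.update_self])
    rw [measurable_iff_comap_le]
    exact le_iSup₂_of_le (f := fun u (_ : u ∈ ({j}ᶜ : Set ℤ)) =>
      MeasurableSpace.comap (x u) inferInstance) k hkj le_rfl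

theorem linFun_update {a x : ℤ → ℝ} (h : Summable fun u => |a u * x u|) (j : ℤ) (y : ℝ) :
    linFun a (Function.update x j y) = linFun (Function.update a j 0) x + a j * y := by
  -- Splitting off one term of a `tsum` needs convergence; changing a single coefficient does not
  -- affect it.
  have hs : Summable fun u => Function.update a j 0 u * x u := by
    refine (summable_abs_iff.1 h).congr_cofinite ?_
    filter_upwards [(Set.finite_singleton j).compl_mem_cofinite] with k hk
    rw [Function.update_of_ne hk]
  have e : ∀ u, a u * Function.update x j y u =
      Function.update a j 0 u * x u + if u = j then a j * y else 0 := by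
    intro u
    rcases eq_or_ne u j with rfl | hu
    · simp
    · simp [hu]
  rw [linFun, linFun]
  simp only [e]
  rw [hs.tsum_add (hasSum_ite_eq j _).summable, tsum_ite_eq]

/-! ### Coupling of correlated Gaussian variables -/

/-- The product of three standard Gaussian measures. -/
noncomputable def gaussTriple : Measure ((ℝ × ℝ) × ℝ) :=
  ((gaussianReal 0 1).prod (gaussianReal 0 1)).prod (gaussianReal 0 1)

instance : IsProbabilityMeasure gaussTriple := by unfold gaussTriple; infer_instance

theorem measurePreserving_affine {a b : ℝ} (hab : a ^ 2 + b ^ 2 = 1) :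
    MeasurePreserving (fun p : ℝ × ℝ => b * p.1 + a * p.2)
      ((gaussianReal 0 1).prod (gaussianReal 0 1)) (gaussianReal 0 1) := by
  refine ⟨by fun_prop, ?_⟩
  have hind : IndepFun (fun p : ℝ × ℝ => b * p.1) (fun p : ℝ × ℝ => a * p.2)
      ((gaussianReal 0 1).prod (gaussianReal 0 1)) :=
    indepFun_prod (X := fun x : ℝ => b * x) (Y := fun x : ℝ => a * x) (by fun_prop) (by fun_prop)
  have h1 : ((gaussianReal 0 1).prod (gaussianReal 0 1)).map (fun p : ℝ × ℝ => b * p.1) =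
      gaussianReal (b * 0) (NNReal.mk (b ^ 2) (sq_nonneg _) * 1) := by
    rw [← gaussianReal_map_const_mul]
    conv_rhs => rw [← (measurePreserving_fst (μ := gaussianReal 0 1) (ν := gaussianReal 0 1)).map_eq]
    rw [Measure.map_map (by fun_prop) (by fun_prop)]
    rfl
  have h2 : ((gaussianReal 0 1).prod (gaussianReal 0 1)).map (fun p : ℝ × ℝ => a * p.2) =
      gaussianReal (a * 0) (NNReal.mk (a ^ 2) (sq_nonneg _) * 1) := by
    rw [← gaussianReal_map_const_mul]
    conv_rhs => rw [← (measurePreserving_snd (μ := gaussianReal 0 1) (ν := gaussianReal 0 1)).map_eq]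
    rw [Measure.map_map (by fun_prop) (by fun_prop)]
    rfl
  have h := gaussianReal_add_gaussianReal_of_indepFun hind h1 h2
  refine h.trans ?_
  congr 1
  · simp
  · ext
    simp only [mul_one, NNReal.coe_add, NNReal.coe_mk, NNReal.coe_one]
    linarith

theorem measurePreserving_coupling_fst {a b : ℝ} (hab : a ^ 2 + b ^ 2 = 1) :
    MeasurePreserving (fun p : (ℝ × ℝ) × ℝ => b * p.1.1 + a * p.1.2)
      gaussTriple (gaussianReal 0 1) :=
  (measurePreserving_affine hab).comp measurePreserving_fst

theorem measurePreserving_coupling_snd {a b : ℝ} (hab : a ^ 2 + b ^ 2 = 1) :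
    MeasurePreserving (fun p : (ℝ × ℝ) × ℝ => b * p.1.1 + a * p.2)
      gaussTriple (gaussianReal 0 1) :=
  (measurePreserving_affine hab).comp (measurePreserving_fst.prod (MeasurePreserving.id _))

/-- The covariance of a Hermite polynomial in two correlated standard Gaussian variables. -/
theorem integral_hermiteReal_coupling {a b : ℝ} (hab : a ^ 2 + b ^ 2 = 1) (q : ℕ) :
    ∫ p, (hermiteReal q).eval (b * p.1.1 + a * p.1.2) * (hermiteReal q).eval (b * p.1.1 + a * p.2)
      ∂gaussTriple = (b ^ 2) ^ q * q.factorial := by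
  have hg := (memLp_polynomial (hermiteReal q) 2 (by simp)).comp_measurePreserving
    (measurePreserving_coupling_fst hab)
  have hh := (memLp_polynomial (hermiteReal q) 2 (by simp)).comp_measurePreserving
    (measurePreserving_coupling_snd hab)
  have h1 := hg.integrable_mul hh
  rw [gaussTriple] at h1 ⊢
  -- Given `p.1.1`, the two factors are independent. Fubini integrates out `p.2` and then `p.1.2`,
  -- each contributing `b ^ q` times `H_q(p.1.1)` by Mehler's formula.
  refine (integral_prod _ h1).trans ?_
  simp only [Pi.mul_apply, Function.comp_apply, integral_const_mul, integral_hermiteReal_affine hab]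
  have h2 := ((memLp_polynomial (hermiteReal q) 2 (by simp)).comp_measurePreserving
    (measurePreserving_affine hab)).integrable_mul
    (((memLp_polynomial (hermiteReal q) 2 (by simp)).const_mul (b ^ q)).comp_measurePreserving
      (measurePreserving_fst (μ := gaussianReal 0 1) (ν := gaussianReal 0 1)))
  refine (Eq.trans ?_ (integral_prod _ h2)).trans ?_
  · rfl
  simp only [Pi.mul_apply, Function.comp_apply, integral_mul_const, integral_hermiteReal_affine hab]
  have e : ∀ x, b ^ q * (hermiteReal q).eval x * (b ^ q * (hermiteReal q).eval x) =
      (b ^ 2) ^ q * ((hermiteReal q).eval x * (hermiteReal q).eval x) := fun x => by ring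
  simp only [e, integral_const_mul, integral_hermiteReal_mul_hermiteReal, if_true]

theorem integral_sq_hermiteReal_sub {a b : ℝ} (hab : a ^ 2 + b ^ 2 = 1) (q : ℕ) :
    ∫ p, ((hermiteReal q).eval (b * p.1.1 + a * p.1.2) -
      (hermiteReal q).eval (b * p.1.1 + a * p.2)) ^ 2 ∂gaussTriple =
        2 * q.factorial * (1 - (b ^ 2) ^ q) := by
  have hH := memLp_polynomial (hermiteReal q) 2 (by simp)
  have hg := hH.comp_measurePreserving (measurePreserving_coupling_fst hab)
  have hh := hH.comp_measurePreserving (measurePreserving_coupling_snd hab)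
  have hsq : ∫ x, (hermiteReal q).eval x ^ 2 ∂gaussianReal 0 1 = q.factorial := by
    simpa [sq] using integral_hermiteReal_mul_hermiteReal q q
  have i1 : ∫ p, (hermiteReal q).eval (b * p.1.1 + a * p.1.2) ^ 2 ∂gaussTriple = q.factorial := by
    rw [← hsq, ← (measurePreserving_coupling_fst hab).map_eq,
      integral_map (by fun_prop) (by fun_prop)]
  have i2 : ∫ p, (hermiteReal q).eval (b * p.1.1 + a * p.2) ^ 2 ∂gaussTriple = q.factorial := by
    rw [← hsq, ← (measurePreserving_coupling_snd hab).map_eq,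
      integral_map (by fun_prop) (by fun_prop)]
  simp only [sub_sq, mul_assoc]
  rw [integral_add (by exact hg.integrable_sq.sub ((hg.integrable_mul hh).const_mul 2))
      (by exact hh.integrable_sq),
    integral_sub (by exact hg.integrable_sq) (by exact (hg.integrable_mul hh).const_mul 2),
    integral_const_mul, i1, i2, integral_hermiteReal_coupling hab]
  ring

/-- Bernoulli's inequality for `b² = 1 - a²` gives `1 - b^(2q) ≤ q a²`; this is the source of the
weight `√(q q!)` and of the linear dependence on `|a|`. -/
theorem eLpNorm_hermiteReal_sub_le {a b : ℝ} (hab : a ^ 2 + b ^ 2 = 1) (q : ℕ) :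
    eLpNorm (fun p : (ℝ × ℝ) × ℝ => (hermiteReal q).eval (b * p.1.1 + a * p.1.2) -
      (hermiteReal q).eval (b * p.1.1 + a * p.2)) 2 gaussTriple ≤
        ENNReal.ofReal (√2 * |a| * √(q * q.factorial)) := by
  have hH := memLp_polynomial (hermiteReal q) 2 (by simp)
  have hm := (hH.comp_measurePreserving (measurePreserving_coupling_fst hab)).sub
    (hH.comp_measurePreserving (measurePreserving_coupling_snd hab))
  have h := hm.eLpNorm_eq_integral_rpow_norm (by simp) (by simp)
  refine h.le.trans (ENNReal.ofReal_le_ofReal ?_)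
  simp only [Pi.sub_apply, Function.comp_apply, ENNReal.toReal_ofNat, Real.rpow_ofNat,
    Real.norm_eq_abs, sq_abs]
  rw [integral_sq_hermiteReal_sub hab, ← one_div, ← Real.sqrt_eq_rpow, ← Real.sqrt_sq_eq_abs,
    ← Real.sqrt_mul (by simp), ← Real.sqrt_mul (by positivity)]
  apply Real.sqrt_le_sqrt
  have hbern : 1 + (q : ℝ) * (-a ^ 2) ≤ (1 + -a ^ 2) ^ q :=
    one_add_mul_le_pow (by nlinarith [sq_nonneg b]) q
  have e : 1 + -a ^ 2 = b ^ 2 := by linarith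
  rw [e] at hbern
  have : 2 * (q.factorial : ℝ) * (1 - (b ^ 2) ^ q) ≤ 2 * (q.factorial : ℝ) * (q * a ^ 2) :=
    mul_le_mul_of_nonneg_left (by linarith) (by positivity)
  linarith

/-- Bound on the effect of resampling one summand of a standard Gaussian variable, in terms of
the Hermite coefficients. -/
theorem eLpNorm_sub_le_hermite {a b : ℝ} (hab : a ^ 2 + b ^ 2 = 1) {ψ : ℝ → ℝ}
    (hψ : MemLp ψ 2 (gaussianReal 0 1)) {c : ℕ → ℝ}
    (hc : ∀ q, c q = 1 / (q.factorial : ℝ) * ∫ y, ψ y * hermiteFun q y ∂gaussianReal 0 1)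
    (hs : Summable fun q : ℕ => √((q + 1 : ℕ) * ((q + 1).factorial : ℝ)) * |c (q + 1)|) :
    eLpNorm (fun p : (ℝ × ℝ) × ℝ => ψ (b * p.1.1 + a * p.1.2) - ψ (b * p.1.1 + a * p.2)) 2
      gaussTriple ≤ ENNReal.ofReal (√2 * |a| *
        ∑' q : ℕ, √((q + 1 : ℕ) * ((q + 1).factorial : ℝ)) * |c (q + 1)|) := by
  set S : ℕ → ℝ[X] := fun N => ∑ q ∈ Finset.range N, C (c q) * hermiteReal q with hS
  have hlim : Tendsto (fun N => eLpNorm (fun x => ψ x - (S N).eval x) 2 (gaussianReal 0 1))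
      atTop (𝓝 0) := by
    have h := tendsto_hermite_expansion hψ
    simp only [← hc] at h
    refine h.congr fun N => ?_
    congr 1
    ext x
    simp [hS, eval_finsetSum, hermiteFun_eq_eval]
  have hs' : Summable fun q : ℕ => √(q * (q.factorial : ℝ)) * |c q| := by
    rw [← summable_nat_add_iff 1]
    exact hs
  -- The weight vanishes at `q = 0`, in line with constants cancelling in the difference.
  have htsum : ∑' q : ℕ, √(q * (q.factorial : ℝ)) * |c q| =
      ∑' q : ℕ, √((q + 1 : ℕ) * ((q + 1).factorial : ℝ)) * |c (q + 1)| := by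
    rw [hs'.tsum_eq_zero_add]
    simp
  rw [← htsum]
  have hmain : ∀ N, eLpNorm (fun p : (ℝ × ℝ) × ℝ => (S N).eval (b * p.1.1 + a * p.1.2) -
      (S N).eval (b * p.1.1 + a * p.2)) 2 gaussTriple ≤ ENNReal.ofReal (√2 * |a| *
        ∑' q : ℕ, √(q * (q.factorial : ℝ)) * |c q|) := by
    intro N
    have e : (fun p : (ℝ × ℝ) × ℝ => (S N).eval (b * p.1.1 + a * p.1.2) -
        (S N).eval (b * p.1.1 + a * p.2)) = ∑ q ∈ Finset.range N, c q •
          fun p : (ℝ × ℝ) × ℝ => (hermiteReal q).eval (b * p.1.1 + a * p.1.2) -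
            (hermiteReal q).eval (b * p.1.1 + a * p.2) := by
      ext p
      simp [hS, eval_finsetSum, Finset.sum_apply, ← Finset.sum_sub_distrib, mul_sub]
    rw [e]
    refine (eLpNorm_sum_le (fun q _ => by fun_prop) one_le_two).trans ?_
    calc _ ≤ ∑ q ∈ Finset.range N,
          ENNReal.ofReal (√2 * |a| * (√(q * (q.factorial : ℝ)) * |c q|)) := by
          refine Finset.sum_le_sum fun q _ => ?_
          rw [eLpNorm_const_smul, Real.enorm_eq_ofReal_abs]
          refine (mul_le_mul_right (eLpNorm_hermiteReal_sub_le hab q) _).trans ?_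
          rw [← ENNReal.ofReal_mul (abs_nonneg _)]
          exact le_of_eq (by ring_nf)
      _ = ENNReal.ofReal (√2 * |a| * ∑ q ∈ Finset.range N, √(q * (q.factorial : ℝ)) * |c q|) := by
          rw [← ENNReal.ofReal_sum_of_nonneg fun q _ => by positivity, Finset.mul_sum]
      _ ≤ _ := by
          refine ENNReal.ofReal_le_ofReal (mul_le_mul_of_nonneg_left ?_ (by positivity))
          exact hs'.sum_le_tsum _ fun q _ => by positivity
  have hSm : ∀ N, MemLp (fun x => (S N).eval x) 2 (gaussianReal 0 1) :=
    fun N => memLp_polynomial _ 2 (by simp)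
  -- Each copy is replaced by its Hermite partial sum. Both marginals are standard normal, so the
  -- two errors are the same `L²` remainder, which tends to zero.
  have hbound : ∀ N, eLpNorm (fun p : (ℝ × ℝ) × ℝ =>
      ψ (b * p.1.1 + a * p.1.2) - ψ (b * p.1.1 + a * p.2)) 2 gaussTriple ≤
      eLpNorm (fun x => ψ x - (S N).eval x) 2 (gaussianReal 0 1) +
      ENNReal.ofReal (√2 * |a| * ∑' q : ℕ, √(q * (q.factorial : ℝ)) * |c q|) +
      eLpNorm (fun x => ψ x - (S N).eval x) 2 (gaussianReal 0 1) := by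
    intro N
    have hd := hψ.sub (hSm N)
    have hd1 := hd.comp_measurePreserving (measurePreserving_coupling_fst hab)
    have hd2 := hd.comp_measurePreserving (measurePreserving_coupling_snd hab)
    have n1 := eLpNorm_comp_measurePreserving (p := 2) hd.1 (measurePreserving_coupling_fst hab)
    have n2 := eLpNorm_comp_measurePreserving (p := 2) hd.1 (measurePreserving_coupling_snd hab)
    have e : (fun p : (ℝ × ℝ) × ℝ => ψ (b * p.1.1 + a * p.1.2) - ψ (b * p.1.1 + a * p.2)) =
        ((ψ - fun x => (S N).eval x) ∘ fun p : (ℝ × ℝ) × ℝ => b * p.1.1 + a * p.1.2) +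
        (fun p : (ℝ × ℝ) × ℝ => (S N).eval (b * p.1.1 + a * p.1.2) -
          (S N).eval (b * p.1.1 + a * p.2)) -
        ((ψ - fun x => (S N).eval x) ∘ fun p : (ℝ × ℝ) × ℝ => b * p.1.1 + a * p.2) := by
      ext p
      simp
    rw [e]
    refine (eLpNorm_sub_le (hd1.1.add (by fun_prop)) hd2.1 one_le_two).trans ?_
    refine add_le_add ((eLpNorm_add_le hd1.1 (by fun_prop) one_le_two).trans
      (add_le_add n1.le (hmain N))) n2.le
  have hlim2 := (hlim.add (tendsto_const_nhds (x := ENNReal.ofReal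
    (√2 * |a| * ∑' q : ℕ, √(q * (q.factorial : ℝ)) * |c q|)))).add hlim
  simp only [zero_add, add_zero] at hlim2
  exact ge_of_tendsto' hlim2 hbound

/-! ### The dependence measure of a transformed Gaussian linear process -/

/-- Lets the centring of `φ ^ k` in the coefficient hypothesis pass to the uncentred process
`X_t^k`. -/
theorem physDep_sub_const (f : (ℤ → ℝ) → ℝ) (c : ℝ) (ε ε' : ℤ → Ω → ℝ) (i : ℤ) :
    physDep P (fun x => f x - c) ε ε' i = physDep P f ε ε' i := by
  simp [physDep, shiftProcess]

theorem hermiteCoeff_eq {Y : Ω → ℝ} (hY : Measurable Y) (hlaw : P.map Y = gaussianReal 0 1)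
    {ψ : ℝ → ℝ} (hψ : Measurable ψ) (q : ℕ) :
    hermiteCoeff P Y ψ q =
      1 / (q.factorial : ℝ) * ∫ y, ψ y * hermiteFun q y ∂gaussianReal 0 1 := by
  have hq : Measurable (hermiteFun q) := by
    have : hermiteFun q = fun x => (hermiteReal q).eval x := funext (hermiteFun_eq_eval q)
    rw [this]
    fun_prop
  rw [hermiteCoeff, ← hlaw, integral_map hY.aemeasurable (by fun_prop)]

/-- The Hermite expansion of a centred function of a standard Gaussian variable. -/
theorem tendsto_hermite_expansion_comp {Y Y' : Ω → ℝ} (hY : Measurable Y)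
    (hlaw : P.map Y = gaussianReal 0 1) (hY' : Measurable Y')
    (hlaw' : P.map Y' = gaussianReal 0 1) {φ : ℝ → ℝ} (hφ : Measurable φ)
    (hL2 : MemLp (fun ω => φ (Y ω)) 2 P) (h0 : ∫ ω, φ (Y ω) ∂P = 0) :
    Tendsto (fun N : ℕ => eLpNorm (fun ω => φ (Y' ω) -
      ∑ q ∈ Finset.Icc 1 N, hermiteCoeff P Y φ q * hermiteFun q (Y' ω)) 2 P) atTop (𝓝 0) := by
  have hφ2 : MemLp φ 2 (gaussianReal 0 1) := by
    rw [← hlaw, memLp_map_measure_iff hφ.aestronglyMeasurable hY.aemeasurable]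
    exact hL2
  have hc0 : hermiteCoeff P Y φ 0 = 0 := by
    simp [hermiteCoeff, hermiteFun, h0]
  -- Centring kills `c_0`, so the partial sum over `range (N + 1)` equals the one over `Icc 1 N`.
  refine ((tendsto_add_atTop_iff_nat 1).2 (tendsto_hermite_expansion hφ2)).congr fun N => ?_
  simp only [← hermiteCoeff_eq hY hlaw hφ]
  have hm : Measurable fun x => φ x - ∑ q ∈ Finset.range (N + 1),
      hermiteCoeff P Y φ q * hermiteFun q x := by
    simp only [hermiteFun_eq_eval]
    fun_prop
  rw [← hlaw', eLpNorm_map_measure hm.aestronglyMeasurable hY'.aemeasurable]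
  congr 1
  ext ω
  simp only [Function.comp_apply]
  rw [Finset.sum_range_succ', hc0, zero_mul, add_zero, Finset.range_eq_Ico,
    Finset.sum_Ico_add' (fun q => hermiteCoeff P Y φ q * hermiteFun q (Y' ω)) 0 N 1]
  rfl

variable [IsProbabilityMeasure P]

/-- The joint law of a Gaussian linear process and its coupled version. -/
theorem map_coupling_eq {ε ε' : ℤ → Ω → ℝ} (hε_meas : ∀ u, Measurable (ε u))
    (hε_indep : iIndepFun ε P) (hε_law : ∀ u, P.map (ε u) = gaussianReal 0 1)
    (hε'_meas : ∀ u, Measurable (ε' u)) (hε'_law : ∀ u, P.map (ε' u) = gaussianReal 0 1)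
    (hε'_indep : IndepFun (fun ω u => ε u ω) (fun ω u => ε' u ω) P)
    {a : ℤ → ℝ} (ha_abs : Summable fun j => |a j|) (ha_sq : HasSum (fun j => a j ^ 2) 1)
    (i : ℤ) {b : ℝ} (hab : a (-i) ^ 2 + b ^ 2 = 1) :
    P.map (fun ω => ((linFun (Function.update a (-i) 0) (fun u => ε (0 - u) ω), ε i ω), ε' i ω)) =
      gaussTriple.map (fun p => ((b * p.1.1, p.1.2), p.2)) := by
  set S : Ω → ℝ := fun ω => linFun (Function.update a (-i) 0) (fun u => ε (0 - u) ω) with hS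
  have hSm : Measurable S := measurable_linFun_comp fun k _ => hε_meas _
  have hind : iIndepFun (fun u => ε (0 - u)) P :=
    hε_indep.precomp (g := fun u : ℤ => 0 - u) sub_right_injective
  have h1 : IndepFun S (ε i) P := by
    have := indepFun_linFun_update (fun u => hε_meas (0 - u)) hind a (-i)
    simpa only [zero_sub, neg_neg, hS] using! this
  have hg : Measurable fun x : ℤ → ℝ => linFun (Function.update a (-i) 0) fun u => x (0 - u) :=
    measurable_linFun_comp fun k _ => measurable_pi_apply _
  have h2 : IndepFun (fun ω => (S ω, ε i ω)) (ε' i) P :=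
    hε'_indep.comp (hg.prodMk (measurable_pi_apply i)) (measurable_pi_apply i)
  -- Removing the coefficient `a (-i)` leaves variance `1 - a (-i) ^ 2 = b ^ 2`, the law of `b`
  -- times a standard normal.
  have hlaw : P.map S = (gaussianReal 0 1).map (fun y => b * y) := by
    rw [gaussianReal_map_const_mul, hS, map_linFun_gaussian
      (v := NNReal.mk (b ^ 2) (sq_nonneg _) * 1) (fun u => hε_meas (0 - u)) hind
      (fun u => hε_law _)]
    · simp
    · refine ha_abs.congr_cofinite ?_
      filter_upwards [(Set.finite_singleton (-i)).compl_mem_cofinite] with k hk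
      rw [Function.update_of_ne hk]
    · have h := ha_sq.update (-i) 0
      have e : Function.update (fun j => a j ^ 2) (-i) 0 =
          fun j => Function.update a (-i) 0 j ^ 2 := by
        ext j
        rcases eq_or_ne j (-i) with rfl | hj
        · simp
        · simp [hj]
      rw [e] at h
      convert! h using 1
      simp only [NNReal.coe_mul, NNReal.coe_mk, NNReal.coe_one]
      linarith
  rw [(indepFun_iff_map_prod_eq_prod_map_map (hSm.prodMk (hε_meas i)).aemeasurable
      (hε'_meas i).aemeasurable).1 h2, (indepFun_iff_map_prod_eq_prod_map_map hSm.aemeasurable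
      (hε_meas i).aemeasurable).1 h1, hlaw, hε_law, hε'_law, gaussTriple]
  have hm : Measurable fun y : ℝ => b * y := by fun_prop
  have : IsProbabilityMeasure ((gaussianReal 0 1).map fun y => b * y) :=
    Measure.isProbabilityMeasure_map hm.aemeasurable
  have hp : MeasurePreserving (fun y : ℝ => b * y) (gaussianReal 0 1)
    ((gaussianReal 0 1).map fun y => b * y) := ⟨hm, rfl⟩
  exact ((hp.prod (MeasurePreserving.id _)).prod (MeasurePreserving.id _)).map_eq.symm

/-- In `Y_0 = ∑ a_j ε_(-j)` the innovation `ε_i` sits at index `-i`. Isolating that term expresses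
both copies through the remainder, `ε_i` and `ε'_i`, whose joint law is known. -/
theorem physDep_eq {ε ε' : ℤ → Ω → ℝ} (hε_meas : ∀ u, Measurable (ε u))
    (hε_indep : iIndepFun ε P) (hε_law : ∀ u, P.map (ε u) = gaussianReal 0 1)
    (hε'_meas : ∀ u, Measurable (ε' u)) (hε'_law : ∀ u, P.map (ε' u) = gaussianReal 0 1)
    (hε'_indep : IndepFun (fun ω u => ε u ω) (fun ω u => ε' u ω) P)
    {a : ℤ → ℝ} (ha_abs : Summable fun j => |a j|) (ha_sq : HasSum (fun j => a j ^ 2) 1)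
    {ψ : ℝ → ℝ} (hψ : Measurable ψ) (i : ℤ) {b : ℝ} (hab : a (-i) ^ 2 + b ^ 2 = 1) :
    physDep P (fun x => ψ (linFun a x)) ε ε' i =
      eLpNorm (fun p : (ℝ × ℝ) × ℝ => ψ (b * p.1.1 + a (-i) * p.1.2) -
        ψ (b * p.1.1 + a (-i) * p.2)) 2 gaussTriple := by
  have hF : Measurable fun p : (ℝ × ℝ) × ℝ => ψ (p.1.1 + a (-i) * p.1.2) -
      ψ (p.1.1 + a (-i) * p.2) :=
    (hψ.comp (by fun_prop)).sub (hψ.comp (by fun_prop))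
  have hT : Measurable fun ω => ((linFun (Function.update a (-i) 0) (fun u => ε (0 - u) ω),
      ε i ω), ε' i ω) :=
    ((measurable_linFun_comp fun k _ => hε_meas _).prodMk (hε_meas i)).prodMk (hε'_meas i)
  have h1 : physDep P (fun x => ψ (linFun a x)) ε ε' i =
      eLpNorm ((fun p : (ℝ × ℝ) × ℝ => ψ (p.1.1 + a (-i) * p.1.2) - ψ (p.1.1 + a (-i) * p.2)) ∘
        fun ω => ((linFun (Function.update a (-i) 0) (fun u => ε (0 - u) ω), ε i ω), ε' i ω))
        2 P := by
    refine eLpNorm_congr_ae ?_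
    filter_upwards [ae_summable_abs_mul (fun u => hε_meas (0 - u)) (fun u => hε_law _) ha_abs]
      with ω hω
    have e1 := linFun_update hω (-i) (ε i ω)
    have e2 := linFun_update hω (-i) (ε' i ω)
    have f1 : Function.update (fun u => ε (0 - u) ω) (-i) (ε i ω) = fun u => ε (0 - u) ω := by
      simp
    have f2 : Function.update (fun u => ε (0 - u) ω) (-i) (ε' i ω) =
        fun u => coupledInnov ε ε' i (0 - u) ω := by
      ext u
      rcases eq_or_ne u (-i) with rfl | hu
      · simp [coupledInnov]
      · have : 0 - u ≠ i := fun h => hu (by omega)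
        simp only [coupledInnov, Function.update_of_ne hu, Function.update_of_ne this]
    rw [f1] at e1
    rw [f2] at e2
    simp only [shiftProcess, Function.comp_apply, e1, e2]
  rw [h1, ← eLpNorm_map_measure hF.aestronglyMeasurable hT.aemeasurable,
    map_coupling_eq hε_meas hε_indep hε_law hε'_meas hε'_law hε'_indep ha_abs ha_sq i hab,
    eLpNorm_map_measure hF.aestronglyMeasurable (by fun_prop)]
  rfl

/-- The effect of a single innovation on a transformed Gaussian linear process. -/
theorem physDep_le {ε ε' : ℤ → Ω → ℝ} (hε_meas : ∀ u, Measurable (ε u))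
    (hε_indep : iIndepFun ε P) (hε_law : ∀ u, P.map (ε u) = gaussianReal 0 1)
    (hε'_meas : ∀ u, Measurable (ε' u)) (hε'_law : ∀ u, P.map (ε' u) = gaussianReal 0 1)
    (hε'_indep : IndepFun (fun ω u => ε u ω) (fun ω u => ε' u ω) P)
    {a : ℤ → ℝ} (ha_abs : Summable fun j => |a j|) (ha_sq : HasSum (fun j => a j ^ 2) 1)
    {ψ : ℝ → ℝ} (hψ : Measurable ψ) {Y : Ω → ℝ} (hY : Measurable Y)
    (hlaw : P.map Y = gaussianReal 0 1) (hL2 : MemLp (fun ω => ψ (Y ω)) 2 P)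
    (hs : Summable fun q : ℕ => √((q + 1 : ℕ) * ((q + 1).factorial : ℝ)) *
      |hermiteCoeff P Y ψ (q + 1)|) (i : ℤ) :
    physDep P (fun x => ψ (linFun a x)) ε ε' i ≤ ENNReal.ofReal (√2 * |a (-i)| *
      ∑' q : ℕ, √((q + 1 : ℕ) * ((q + 1).factorial : ℝ)) * |hermiteCoeff P Y ψ (q + 1)|) := by
  have hle : a (-i) ^ 2 ≤ 1 := by
    have := ha_sq.summable.le_tsum (-i) fun j _ => sq_nonneg (a j)
    rwa [ha_sq.tsum_eq] at this
  have hab : a (-i) ^ 2 + √(1 - a (-i) ^ 2) ^ 2 = 1 := by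
    rw [Real.sq_sqrt (by linarith)]
    ring
  have hψ2 : MemLp ψ 2 (gaussianReal 0 1) := by
    rw [← hlaw, memLp_map_measure_iff hψ.aestronglyMeasurable hY.aemeasurable]
    exact hL2
  rw [physDep_eq hε_meas hε_indep hε_law hε'_meas hε'_law hε'_indep ha_abs ha_sq hψ i hab]
  exact eLpNorm_sub_le_hermite hab hψ2 (hermiteCoeff_eq hY hlaw hψ) hs

theorem memLp_two_pow {Ω : Type*} [MeasurableSpace Ω] {P : Measure Ω} [IsProbabilityMeasure P]
    {f : Ω → ℝ} {k m : ℕ} (hk : 1 ≤ k) (hkm : k ≤ m) (hf : MemLp f (2 * (m : ℝ≥0∞)) P) :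
    MemLp (fun ω => f ω ^ k) 2 P := by
  have hk0 : (k : ℝ≥0∞) ≠ 0 := by exact_mod_cast (by omega : k ≠ 0)
  have h := hf.mono_exponent (p := 2 * (k : ℝ≥0∞)) (by gcongr)
  rw [← memLp_norm_rpow_iff (q := (k : ℝ≥0∞)) h.1 hk0 (by simp),
    ENNReal.mul_div_cancel_right hk0 (by simp)] at h
  have hm : AEStronglyMeasurable (fun ω => f ω ^ k) P := hf.1.pow k
  rw [← memLp_norm_iff hm]
  simpa using h

end WeakDep

theorem mainTheorem6 {Ω : Type*} [MeasurableSpace Ω] (P : Measure Ω) [IsProbabilityMeasure P]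
    -- i.i.d. standard normal innovations
    (ε : ℤ → Ω → ℝ) (hε_meas : ∀ u, Measurable (ε u)) (hε_indep : iIndepFun ε P)
    (hε_law : ∀ u, P.map (ε u) = gaussianReal 0 1)
    -- an independent copy of the sequence of innovations
    (ε' : ℤ → Ω → ℝ) (hε'_meas : ∀ u, Measurable (ε' u))
    (hε'_law : IdentDistrib (fun ω u => ε' u ω) (fun ω u => ε u ω) P P)
    (hε'_indep : IndepFun (fun ω u => ε u ω) (fun ω u => ε' u ω) P)
    -- the coefficients of the linear process and the transformation
    (a : ℤ → ℝ) (ha_abs : Summable fun j => |a j|) (ha_sq : HasSum (fun j => a j ^ 2) 1)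
    (φ : ℝ → ℝ) (hφ : Measurable φ)
    -- the Gaussian linear process
    (Y : ℤ → Ω → ℝ) (hY : Y = WeakDep.shiftProcess (WeakDep.linFun a) ε) :
    -- the series defining the linear process converges absolutely almost surely
    (∀ t : ℤ, ∀ᵐ ω ∂P, Summable fun j : ℤ => |a j * ε (t - j) ω|) ∧
    -- Hermite expansion, with convergence in mean square
    (MemLp (fun ω => φ (Y 0 ω)) 2 P → ∫ ω, φ (Y 0 ω) ∂P = 0 →
      ∀ t : ℤ, Tendsto (fun N : ℕ => eLpNorm (fun ω => φ (Y t ω) -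
        ∑ q ∈ Finset.Icc 1 N, WeakDep.hermiteCoeff P (Y 0) φ q * WeakDep.hermiteFun q (Y t ω))
          2 P) atTop (𝓝 0)) ∧
    -- the dependence condition
    (∀ m : ℕ, MemLp (fun ω => φ (Y 0 ω)) (2 * (m : ℝ≥0∞)) P →
      (Summable fun j : ℤ => (j : ℝ) ^ 2 * |a j|) →
      (∀ k ∈ Finset.Icc 1 m, Summable fun q : ℕ =>
        √((q + 1 : ℕ) * ((q + 1).factorial : ℝ)) *
          |WeakDep.hermiteCoeff P (Y 0) (fun y => φ y ^ k - ∫ ω, φ (Y 0 ω) ^ k ∂P) (q + 1)|) →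
      WeakDep.DependenceCondition P (fun x => φ (WeakDep.linFun a x)) ε ε' m) := by
  have hε'_law1 : ∀ u, P.map (ε' u) = gaussianReal 0 1 := fun u => by
    rw [← hε_law u]
    exact (hε'_law.comp (measurable_pi_apply u)).map_eq
  have hYm : ∀ t, Measurable (Y t) := fun t => by
    rw [hY]
    exact WeakDep.measurable_linFun_comp fun k _ => hε_meas _
  have hYlaw : ∀ t, P.map (Y t) = gaussianReal 0 1 := fun t => by
    rw [hY]
    exact WeakDep.map_linFun_gaussian (fun u => hε_meas (t - u))
      (hε_indep.precomp (g := fun u : ℤ => t - u) sub_right_injective) (fun u => hε_law _) ha_abs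
      (by simpa using ha_sq)
  refine ⟨fun t => WeakDep.ae_summable_abs_mul (fun u => hε_meas (t - u)) (fun u => hε_law _)
    ha_abs, fun hL2 h0 t => WeakDep.tendsto_hermite_expansion_comp (hYm 0) (hYlaw 0) (hYm t)
      (hYlaw t) hφ hL2 h0, fun m hL hj hs => ?_⟩
  set K : ℕ → ℝ := fun k => ∑' q : ℕ, √((q + 1 : ℕ) * ((q + 1).factorial : ℝ)) *
    |WeakDep.hermiteCoeff P (Y 0) (fun y => φ y ^ k - ∫ ω, φ (Y 0 ω) ^ k ∂P) (q + 1)| with hK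
  have hK0 : ∀ k, 0 ≤ K k := fun k => tsum_nonneg fun q => by positivity
  have hdep : ∀ i, ∀ k ∈ Finset.Icc 1 m,
      WeakDep.physDep P (fun x => φ (WeakDep.linFun a x) ^ k) ε ε' i ≤
        ENNReal.ofReal (√2 * |a (-i)| * K k) := by
    intro i k hk
    obtain ⟨hk1, hkm⟩ := Finset.mem_Icc.1 hk
    rw [← WeakDep.physDep_sub_const _ (∫ ω, φ (Y 0 ω) ^ k ∂P)]
    exact WeakDep.physDep_le hε_meas hε_indep hε_law hε'_meas hε'_law1 hε'_indep ha_abs ha_sq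
      (ψ := fun y => φ y ^ k - ∫ ω, φ (Y 0 ω) ^ k ∂P) ((hφ.pow_const k).sub_const _) (hYm 0)
      (hYlaw 0) ((WeakDep.memLp_two_pow hk1 hkm hL).sub (memLp_const _)) (hs k hk) i
  -- The reflection `i ↦ -i` preserves `i²`, turning `a (-i)` back into the hypothesis on `a`.
  have hsum : Summable fun i : ℤ => ((i : ℝ) ^ 2 * |a (-i)|) * (√2 * ∑ k ∈ Finset.Icc 1 m, K k) := by
    refine Summable.mul_right _ ?_
    simpa [Function.comp_def] using! hj.comp_injective neg_injective
  refine lt_of_le_of_lt (ENNReal.tsum_le_tsum fun i => ?_) hsum.tsum_ofReal_lt_top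
  calc _ ≤ ∑ k ∈ Finset.Icc 1 m, ENNReal.ofReal ((i : ℝ) ^ 2 * (√2 * |a (-i)| * K k)) := by
        refine Finset.sum_le_sum fun k hk => ?_
        rw [ENNReal.ofReal_mul (sq_nonneg _)]
        exact mul_le_mul_right (hdep i k hk) _
    _ = _ := by
        rw [← ENNReal.ofReal_sum_of_nonneg fun k _ => by have := hK0 k; positivity,
          ← Finset.mul_sum, ← Finset.mul_sum]
        ring_nf
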